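/- Let $n\ge 0$ be an integer and let $Q_0(n)$ denote the number of partitions of $n$ into distinct parts, none of which is divisible by $4$. A Göllnitz–Gordon partition is a partition whose parts differ by at least $2$, and by more than $2$ whenever one of the two parts involved is even. For a part $b$ of a partition $\pi$, let $t(b)=t(b;\pi)$ denote the number of odd parts of $\pi$ that are less than $b$. Let $\mathcal S^*$ be the set of Göllnitz–Gordon partitions $\pi$ such that every even part $b$ of $\pi$ satisfies $$b\equiv 2(t(b)-1)\pmod 4.$$ A chain of $\pi$ is a maximal string of parts of $\pi$ in which successive parts differ by exactly $2$; all parts of a chain have the same parity, and the chain is called odd if they are odd. Let $\lambda(\chi)$ denote the least part of the chain $\chi$. Define the weight of a chain $\chi$ of $\pi\in\mathcal S^*$ by $\omega(\chi)=2$ if $\chi$ is an odd chain, $\lambda(\chi)\ge 3$ and $\lambda(\chi)\equiv 2t(\lambda(\chi))-1\pmod 4$, and by $\omega(\chi)=1$ otherwise, and let $\omega(\pi)=\prod_{\chi}\omega(\chi)$, the product being over all chains $\chi$ of $\pi$. Then $$Q_0(n)=\sum_{\pi\in\mathcal S^*,\ \sigma(\pi)=n}\omega(\pi),$$ where $\sigma(\pi)$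 is the sum of the parts of $\pi$. -/

import Mathlib

/-- `oddBelow π b` is the statistic `t(b; π)`: the number of odd parts of `π` that are `< b`. -/
def oddBelow {n : ℕ} (π : n.Partition) (b : ℕ) : ℕ :=
  (π.parts.filter (fun a => Odd a ∧ a < b)).card

/-- A Göllnitz-Gordon partition: the parts differ by `≥ 2` (in particular they are distinct),
and by `> 2` whenever one of the two parts is even. -/
def IsGollnitzGordon {n : ℕ} (π : n.Partition) : Prop :=
  π.parts.Nodup ∧
    ∀ a ∈ π.parts, ∀ b ∈ π.parts, a < b →
      a + 2 ≤ b ∧ (Even a ∨ Even b → a + 2 < b)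

/-- A special Göllnitz-Gordon partition: a Göllnitz-Gordon partition in which every even part `b`
satisfies `b ≡ 2 (t(b) - 1) (mod 4)`. The congruence is one between integers. -/
def IsSpecial {n : ℕ} (π : n.Partition) : Prop :=
  IsGollnitzGordon π ∧
    ∀ b ∈ π.parts, Even b → (b : ℤ) ≡ 2 * ((oddBelow π b : ℤ) - 1) [ZMOD 4]

/-- `χ` is a nonempty string `a, a + 2, …, a + 2 (k - 1)` of numbers with successive
difference exactly `2`. -/
def IsTwoString (χ : Finset ℕ) : Prop :=
  ∃ a k : ℕ, 0 < k ∧ χ = (Finset.range k).image (fun i => a + 2 * i)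

open Classical in
/-- The chains of `π`: the maximal strings of parts of `π` differing by exactly `2`. -/
noncomputable def chains {n : ℕ} (π : n.Partition) : Finset (Finset ℕ) :=
  π.parts.toFinset.powerset.filter
    (fun χ => Maximal (fun ψ => IsTwoString ψ ∧ ψ ⊆ π.parts.toFinset) χ)

/-- The least part `λ(χ)` of a (nonempty) chain `χ`. -/
noncomputable def leastPart (χ : Finset ℕ) : ℕ := sInf (χ : Set ℕ)

open Classical in
/-- The weight `ω(χ)` of a chain `χ` of `π`. -/
noncomputable def chainWeight {n : ℕ} (π : n.Partition) (χ : Finset ℕ) : ℕ :=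
  if (∀ b ∈ χ, Odd b) ∧ 3 ≤ leastPart χ ∧
      (leastPart χ : ℤ) ≡ 2 * (oddBelow π (leastPart χ) : ℤ) - 1 [ZMOD 4]
  then 2 else 1

/-- The weight `ω(π)`: the product of the weights of all chains of `π`. -/
noncomputable def weight {n : ℕ} (π : n.Partition) : ℕ :=
  ∏ χ ∈ chains π, chainWeight π χ

/-- `Q₀(n)`: the number of partitions of `n` into distinct parts, none of them divisible by `4`. -/
def Q₀ (n : ℕ) : ℕ :=
  (Finset.univ.filter
    (fun π : n.Partition => π.parts.Nodup ∧ ∀ b ∈ π.parts, ¬ b ≡ 0 [MOD 4])).card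

open Polynomial Finset

/-! Fix the number `j` of odd parts and bound all parts by `2m`. The weighted generating function
then factors (`special_gf`) as that of the `j`-subsets of `{1, 3, …, 2m - 1}` times `∏ (1 + X ^
(2e))` over odd `e ≤ m - j`. As `m` grows, the sum over `j` tends to `∏ (1 + X ^ (2i + 1)) · ∏ (1 +
X ^ (2e))` over all `i ≥ 0` and odd `e`. Since the `2e` are the numbers `≡ 2 (mod 4)`, this is the
generating function of `Q₀`.

The factorization goes by induction on `m`, jointly with a formula for sets whose greatest element
is `2m + 1`. Deleting the greatest part works because `t(b)` only looks below `b`, so the conditions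
and weights of the other parts do not change. Where weight 2 occurs, the two copies of a term feed
the two Pascal recurrences `oddSetGF_succ` and `oddSetGF_succ'`. Chains enter only through their
least parts (`weight_eq`). -/

/-- The number of odd elements of `S` below `b`. -/
def oddCountBelow (S : Finset ℕ) (b : ℕ) : ℕ := (S.filter (fun a => Odd a ∧ a < b)).card

/-- The number of odd elements of `S`. -/
def oddCount (S : Finset ℕ) : ℕ := (S.filter (fun a => Odd a)).card

/-- `IsSpecial` for the set of parts of a partition into distinct parts. -/
def IsSpecialSet (S : Finset ℕ) : Prop :=
  0 ∉ S ∧ (∀ a ∈ S, ∀ b ∈ S, a < b → a + 2 ≤ b ∧ (Even a ∨ Even b → a + 2 < b)) ∧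
    ∀ b ∈ S, Even b → b % 4 = (2 * oddCountBelow S b + 2) % 4

open Classical in
/-- The weight of a set of parts, as a product over the least elements of its odd chains. -/
noncomputable def setWeight (S : Finset ℕ) : ℕ :=
  ∏ b ∈ S, if Odd b ∧ (∀ a ∈ S, a + 2 ≠ b) ∧ b % 4 = (2 * oddCountBelow S b + 3) % 4 then 2 else 1

/-! ### Adjoining a new greatest part -/

lemma oddCountBelow_insert {S : Finset ℕ} {N b : ℕ} (hb : b ≤ N) :
    oddCountBelow (insert N S) b = oddCountBelow S b := by
  unfold oddCountBelow
  rw [filter_insert, if_neg (by omega)]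

lemma oddCountBelow_top {S : Finset ℕ} {N : ℕ} (h : ∀ a ∈ S, a < N) :
    oddCountBelow S N = oddCount S := by
  unfold oddCountBelow oddCount
  congr 1
  exact filter_congr fun a ha => by simp [h a ha]

lemma oddCount_insert {S : Finset ℕ} {N : ℕ} (h : ∀ a ∈ S, a < N) :
    oddCount (insert N S) = oddCount S + if Odd N then 1 else 0 := by
  unfold oddCount
  rw [filter_insert]
  split_ifs with hN
  · rw [card_insert_of_notMem]
    intro hm
    exact absurd (h N (mem_filter.1 hm).1) (lt_irrefl _)
  · rfl

lemma isSpecialSet_insert {S : Finset ℕ} {N : ℕ} (h : ∀ a ∈ S, a < N) :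
    IsSpecialSet (insert N S) ↔ N ≠ 0 ∧ IsSpecialSet S ∧
      (∀ a ∈ S, a + 2 ≤ N ∧ (Even a ∨ Even N → a + 2 < N)) ∧
      (Even N → N % 4 = (2 * oddCount S + 2) % 4) := by
  have hc : ∀ b ∈ S, oddCountBelow (insert N S) b = oddCountBelow S b := fun b hb =>
    oddCountBelow_insert (h b hb).le
  have hN : oddCountBelow (insert N S) N = oddCount S := by
    rw [oddCountBelow_insert le_rfl, oddCountBelow_top h]
  constructor
  · rintro ⟨h0, hg, hs⟩
    refine ⟨fun e => h0 (by simp [e]), ⟨fun e => h0 (mem_insert_of_mem e), ?_, ?_⟩, ?_, ?_⟩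
    · exact fun a ha b hb => hg a (mem_insert_of_mem ha) b (mem_insert_of_mem hb)
    · exact fun b hb he => by rw [← hc b hb]; exact hs b (mem_insert_of_mem hb) he
    · exact fun a ha => hg a (mem_insert_of_mem ha) N (mem_insert_self _ _) (h a ha)
    · exact fun he => by rw [← hN]; exact hs N (mem_insert_self _ _) he
  · rintro ⟨hN0, ⟨h0, hg, hs⟩, ht, he⟩
    refine ⟨by simp [Ne.symm hN0, h0], ?_, ?_⟩
    · intro a ha b hb hab
      rcases mem_insert.1 ha with ha' | ha' <;> rcases mem_insert.1 hb with hb' | hb'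
      · omega
      · exact absurd (h b hb') (by omega)
      · subst hb'; exact ht a ha'
      · exact hg a ha' b hb' hab
    · intro b hb hev
      rcases mem_insert.1 hb with rfl | hb
      · rw [hN]; exact he hev
      · rw [hc b hb]; exact hs b hb hev

open Classical in
lemma setWeight_insert {S : Finset ℕ} {N : ℕ} (h : ∀ a ∈ S, a < N) :
    setWeight (insert N S) =
      (if Odd N ∧ (∀ a ∈ S, a + 2 ≠ N) ∧ N % 4 = (2 * oddCount S + 3) % 4 then 2 else 1) *
        setWeight S := by
  have hn : N ∉ S := fun hm => lt_irrefl _ (h N hm)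
  unfold setWeight
  rw [prod_insert hn]
  congr 1
  · rw [oddCountBelow_insert le_rfl, oddCountBelow_top h]
    simp
  · refine prod_congr rfl fun b hb => ?_
    have := h b hb
    rw [oddCountBelow_insert this.le]
    have e : (∀ a ∈ insert N S, a + 2 ≠ b) ↔ ∀ a ∈ S, a + 2 ≠ b := by
      simp only [mem_insert, forall_eq_or_imp, and_iff_right_iff_imp]
      intro _; omega
    simp only [e]

/-! ### Generating functions and their recurrences -/

open Classical in
/-- The contribution of `S` to the generating function of special sets with `j` odd elements. -/
noncomputable def specialTerm (j : ℕ) (S : Finset ℕ) : ℕ[X] :=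
  if IsSpecialSet S ∧ oddCount S = j then (setWeight S : ℕ[X]) * X ^ (∑ i ∈ S, i) else 0

/-- Generating function of special sets of numbers `< N` with `j` odd elements. -/
noncomputable def specialGF (N j : ℕ) : ℕ[X] := ∑ S ∈ (range N).powerset, specialTerm j S

/-- Generating function of special sets with greatest element `N` and `j` odd elements. -/
noncomputable def specialTopGF (N j : ℕ) : ℕ[X] :=
  ∑ S ∈ (range N).powerset, specialTerm j (insert N S)

lemma specialGF_succ (N j : ℕ) : specialGF (N + 1) j = specialGF N j + specialTopGF N j := by
  unfold specialGF specialTopGF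
  rw [range_add_one, sum_powerset_insert (by simp)]

lemma lt_of_mem_powerset_range {N : ℕ} {S : Finset ℕ} (h : S ∈ (range N).powerset) :
    ∀ a ∈ S, a < N := fun _ ha => mem_range.1 (mem_powerset.1 h ha)

lemma specialTopGF_zero_left (j : ℕ) : specialTopGF 0 j = 0 := by
  simp [specialTopGF, specialTerm, IsSpecialSet]

lemma specialGF_zero (j : ℕ) : specialGF 0 j = if j = 0 then 1 else 0 := by
  simp [specialGF, specialTerm, IsSpecialSet, oddCount, setWeight, eq_comm]

lemma specialTopGF_odd_zero (m : ℕ) : specialTopGF (2 * m + 1) 0 = 0 := by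
  refine sum_eq_zero fun S hS => if_neg ?_
  rw [oddCount_insert (lt_of_mem_powerset_range hS)]
  simp

/-- An even greatest part forces all others below `2m`, and its congruence modulo 4 reduces to `m ≡
j (mod 2)`. -/
lemma specialTopGF_even (m j : ℕ) :
    specialTopGF (2 * m + 2) j =
      if m % 2 = j % 2 then X ^ (2 * m + 2) * specialGF (2 * m) j else 0 := by
  have hev : Even (2 * m + 2) := ⟨m + 1, by ring⟩
  have hno : ¬ Odd (2 * m + 2) := by simpa using hev
  have key : ∀ S ∈ (range (2 * m)).powerset, specialTerm j (insert (2 * m + 2) S) =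
      if m % 2 = j % 2 then X ^ (2 * m + 2) * specialTerm j S else 0 := by
    intro S hS
    have hlt := lt_of_mem_powerset_range hS
    have hlt' : ∀ a ∈ S, a < 2 * m + 2 := fun a ha => by have := hlt a ha; omega
    have hgap : ∀ a ∈ S, a + 2 ≤ 2 * m + 2 ∧ (Even a ∨ Even (2 * m + 2) → a + 2 < 2 * m + 2) :=
      fun a ha => by have := hlt a ha; omega
    have hw : setWeight (insert (2 * m + 2) S) = setWeight S := by
      rw [setWeight_insert hlt', if_neg (fun h => hno h.1), one_mul]
    unfold specialTerm
    rw [isSpecialSet_insert hlt', oddCount_insert hlt', hw, if_neg hno, add_zero,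
      sum_insert (fun h => by have := hlt' _ h; omega)]
    by_cases hs : IsSpecialSet S ∧ oddCount S = j
    · rw [if_pos hs]
      have hj := hs.2
      by_cases hm : m % 2 = j % 2
      · rw [if_pos hm, if_pos ⟨⟨by omega, hs.1, hgap, fun _ => by omega⟩, hj⟩]
        ring
      · rw [if_neg hm, if_neg]
        intro h
        have := h.1.2.2.2 hev
        omega
    · rw [if_neg hs, if_neg (fun h => hs ⟨h.1.2.1, h.2⟩)]
      simp
  unfold specialTopGF
  rw [← sum_subset (powerset_mono.2 (range_mono (by omega : 2 * m ≤ 2 * m + 2))), sum_congr rfl key]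
  · split_ifs
    · rw [specialGF, mul_sum]
    · simp
  · intro S hS hS'
    refine if_neg fun h => hS' ?_
    have h3 := ((isSpecialSet_insert (lt_of_mem_powerset_range hS)).1 h.1).2.2.1
    refine mem_powerset.2 fun a ha => mem_range.2 ?_
    have := (h3 a ha).2 (Or.inr hev)
    omega

lemma specialTopGF_one (j : ℕ) : specialTopGF 1 (j + 1) = if j = 0 then X else 0 := by
  have h0 : ¬ IsSpecialSet {1, 0} := fun h => h.1 (by simp)
  have h1 : IsSpecialSet {1} := by simp [IsSpecialSet]
  have h2 : oddCount {1} = 1 := by simp [oddCount, filter_singleton]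
  have h3 : setWeight {1} = 1 := by simp [setWeight, oddCountBelow, filter_singleton]
  rw [specialTopGF, show range 1 = insert 0 ∅ from rfl, sum_powerset_insert (by simp)]
  simp [specialTerm, h0, h1, h2, h3, eq_comm]

/-- If `2m + 1` is present, the new part extends its chain and the weight is unchanged. Otherwise it
starts a chain, of weight 2 exactly when `m ≡ j (mod 2)`. -/
lemma specialTopGF_odd (m j : ℕ) :
    specialTopGF (2 * m + 3) (j + 1) = X ^ (2 * m + 3) * (specialTopGF (2 * m + 1) j +
      (if m % 2 = j % 2 then 2 else 1) * specialGF (2 * m + 1) j) := by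
  have hodd : Odd (2 * m + 3) := ⟨m + 1, by ring⟩
  have hne : ¬ Even (2 * m + 3) := by simpa using hodd
  have key : ∀ S ∈ (range (2 * m + 2)).powerset, specialTerm (j + 1) (insert (2 * m + 3) S) =
      X ^ (2 * m + 3) * ((if 2 * m + 1 ∉ S ∧ m % 2 = j % 2 then 2 else 1) * specialTerm j S) := by
    intro S hS
    have hlt := lt_of_mem_powerset_range hS
    have hlt' : ∀ a ∈ S, a < 2 * m + 3 := fun a ha => by have := hlt a ha; omega
    have hgap : ∀ a ∈ S, a + 2 ≤ 2 * m + 3 ∧ (Even a ∨ Even (2 * m + 3) → a + 2 < 2 * m + 3) := by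
      refine fun a ha => ⟨by have := hlt a ha; omega, fun h => ?_⟩
      have := hlt a ha
      have ha' := h.resolve_right hne
      obtain ⟨k, hk⟩ := ha'
      omega
    have hch : (∀ a ∈ S, a + 2 ≠ 2 * m + 3) ↔ 2 * m + 1 ∉ S :=
      ⟨fun h hm => h _ hm rfl, fun h a ha e => h (by rwa [show 2 * m + 1 = a by omega])⟩
    unfold specialTerm
    rw [isSpecialSet_insert hlt', oddCount_insert hlt', setWeight_insert hlt', if_pos hodd,
      sum_insert (fun h => by have := hlt' _ h; omega)]
    simp only [hch]
    have hiff : ((2 * m + 3 ≠ 0 ∧ IsSpecialSet S ∧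
        (∀ a ∈ S, a + 2 ≤ 2 * m + 3 ∧ (Even a ∨ Even (2 * m + 3) → a + 2 < 2 * m + 3)) ∧
        (Even (2 * m + 3) → (2 * m + 3) % 4 = (2 * oddCount S + 2) % 4)) ∧
        oddCount S + 1 = j + 1) ↔ IsSpecialSet S ∧ oddCount S = j :=
      ⟨fun h => ⟨h.1.2.1, by omega⟩, fun h => ⟨⟨by omega, h.1, hgap, fun e => absurd e hne⟩, by omega⟩⟩
    by_cases hs : IsSpecialSet S ∧ oddCount S = j
    · have hm : (2 * m + 3) % 4 = (2 * oddCount S + 3) % 4 ↔ m % 2 = j % 2 := by omega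
      simp only [hodd, true_and, hm]
      rw [if_pos (hiff.2 hs), if_pos hs]
      split_ifs <;> push_cast <;> ring
    · rw [if_neg (mt hiff.1 hs), if_neg hs]
      simp
  have hsub : specialTopGF (2 * m + 3) (j + 1) =
      ∑ S ∈ (range (2 * m + 2)).powerset, specialTerm (j + 1) (insert (2 * m + 3) S) := by
    unfold specialTopGF
    refine (sum_subset (powerset_mono.2 (range_mono (by omega))) ?_).symm
    intro S hS hS'
    refine if_neg fun h => hS' ?_
    have h3 := ((isSpecialSet_insert (lt_of_mem_powerset_range hS)).1 h.1).2.2.1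
    refine mem_powerset.2 fun a ha => mem_range.2 ?_
    have := (h3 a ha).1
    omega
  rw [hsub, sum_congr rfl key, ← mul_sum, range_add_one, sum_powerset_insert (by simp),
    add_comm (specialTopGF _ _)]
  congr 2
  · rw [specialGF, mul_sum]
    refine sum_congr rfl fun S hS => ?_
    have : 2 * m + 1 ∉ S := fun h => by have := lt_of_mem_powerset_range hS _ h; omega
    simp only [this, not_false_eq_true, true_and]
  · refine sum_congr rfl fun S hS => ?_
    rw [if_neg (by simp), one_mul]

/-! ### Pascal recurrences and the closed form -/

/-- Generating function of the `j`-element sets of odd numbers `< 2 * m`. -/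
noncomputable def oddSetGF : ℕ → ℕ → ℕ[X]
  | _, 0 => 1
  | 0, _ + 1 => 0
  | m + 1, j + 1 => oddSetGF m (j + 1) + X ^ (2 * m + 1) * oddSetGF m j

lemma oddSetGF_zero_right (m : ℕ) : oddSetGF m 0 = 1 := by cases m <;> rfl

lemma oddSetGF_succ (m j : ℕ) :
    oddSetGF (m + 1) (j + 1) = oddSetGF m (j + 1) + X ^ (2 * m + 1) * oddSetGF m j := rfl

lemma oddSetGF_eq_zero {m j : ℕ} (h : m < j) : oddSetGF m j = 0 := by
  induction m generalizing j with
  | zero => obtain ⟨k, rfl⟩ : ∃ k, j = k + 1 := ⟨j - 1, by omega⟩; rfl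
  | succ m ih =>
    obtain ⟨k, rfl⟩ : ∃ k, j = k + 1 := ⟨j - 1, by omega⟩
    rw [oddSetGF_succ, ih (by omega), ih (by omega)]; simp

/-- Split by whether 1, rather than the largest odd number, lies in the set, then lower the
remaining elements by 2. -/
lemma oddSetGF_succ' (m j : ℕ) : oddSetGF (m + 1) (j + 1) =
    X ^ (2 * j + 2) * oddSetGF m (j + 1) + X ^ (2 * j + 1) * oddSetGF m j := by
  induction m generalizing j with
  | zero => cases j <;> simp [oddSetGF]
  | succ m ih =>
    rw [oddSetGF_succ (m + 1) j]
    conv_lhs => rw [ih j]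
    conv_rhs => rw [oddSetGF_succ m j]
    cases j with
    | zero => simp only [oddSetGF_zero_right]; ring
    | succ k =>
      conv_lhs => rw [ih k]
      conv_rhs => rw [oddSetGF_succ m k]
      ring

lemma X_pow_dvd_oddSetGF (m j : ℕ) : X ^ j ∣ oddSetGF m j := by
  induction m generalizing j with
  | zero => cases j <;> simp [oddSetGF]
  | succ m ih =>
    cases j with
    | zero => simp
    | succ j =>
      rw [oddSetGF_succ]
      refine dvd_add (ih _) ?_
      rw [pow_succ']
      exact mul_dvd_mul (dvd_pow_self _ (by omega)) (ih j)

lemma sum_oddSetGF (m : ℕ) :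
    ∑ j ∈ range (m + 1), oddSetGF m j = ∏ i ∈ range m, (1 + X ^ (2 * i + 1)) := by
  induction m with
  | zero => simp [oddSetGF]
  | succ m ih =>
    rw [sum_range_succ', prod_range_succ, ← ih]
    simp only [oddSetGF_succ, sum_add_distrib, ← mul_sum]
    have := sum_range_succ' (fun j => oddSetGF m j) (m + 1)
    rw [sum_range_succ, oddSetGF_eq_zero (lt_add_one m), add_zero] at this
    rw [oddSetGF_zero_right] at this ⊢
    rw [this]
    ring

/-- Generating function of sets of numbers `2 * e` with `e < v` odd. -/
noncomputable def twiceOddGF (v : ℕ) : ℕ[X] :=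
  ∏ e ∈ (range v).filter (fun e => e % 2 = 1), (1 + X ^ (2 * e))

lemma twiceOddGF_succ (v : ℕ) :
    twiceOddGF (v + 1) = twiceOddGF v * if v % 2 = 1 then 1 + X ^ (2 * v) else 1 := by
  unfold twiceOddGF
  rw [range_add_one, filter_insert]
  split_ifs with h
  · rw [prod_insert (by simp), mul_comm]
  · simp

lemma special_gf (m : ℕ) :
    (∀ j, specialGF (2 * m + 1) j = oddSetGF m j * twiceOddGF (m + 1 - j)) ∧
    ∀ j, specialTopGF (2 * m + 1) (j + 1) = (if (m - j) % 2 = 1 then 2 else 1) *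
      (X ^ (2 * m + 1) * oddSetGF m j * twiceOddGF (m - j)) := by
  induction m with
  | zero =>
    constructor
    · intro j
      rw [show 2 * 0 + 1 = 0 + 1 from rfl, specialGF_succ, specialGF_zero, specialTopGF_zero_left]
      cases j <;> simp [oddSetGF, twiceOddGF, filter_singleton]
    · intro j
      rw [show 2 * 0 + 1 = 1 from rfl, specialTopGF_one]
      cases j <;> simp [oddSetGF, twiceOddGF]
  | succ m ih =>
    obtain ⟨hF, hL⟩ := ih
    constructor
    · intro j
      have hrec : specialGF (2 * (m + 1) + 1) j = specialGF (2 * m + 1) j +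
          specialTopGF (2 * m + 1) j + specialTopGF (2 * m + 2) j := by
        rw [show 2 * (m + 1) + 1 = 2 * m + 1 + 1 + 1 by ring, specialGF_succ, specialGF_succ]
      have htop : specialTopGF (2 * m + 2) j =
          if m % 2 = j % 2 then X ^ (2 * m + 2) * specialGF (2 * m + 1) j else 0 := by
        rw [specialTopGF_even]
        split_ifs with h
        · rw [specialGF_succ]
          -- The parity that allows `2m + 2` as a greatest part excludes `2m`.
          have : specialTopGF (2 * m) j = 0 := by
            cases m with
            | zero => exact specialTopGF_zero_left j
            | succ k =>
              rw [show 2 * (k + 1) = 2 * k + 2 by ring, specialTopGF_even, if_neg (by omega)]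
          rw [this, add_zero]
        · rfl
      rw [hrec, htop, hF]
      -- For `j > m + 1` the subtractions truncate, but every `oddSetGF` factor vanishes.
      rcases lt_or_ge (m + 1) j with hj | hj
      · obtain ⟨i, rfl⟩ : ∃ i, j = i + 1 := ⟨j - 1, by omega⟩
        rw [hL, oddSetGF_eq_zero hj, oddSetGF_eq_zero (show m < i + 1 by omega),
          oddSetGF_eq_zero (show m < i by omega)]
        simp
      · rw [show m + 1 + 1 - j = (m + 1 - j) + 1 by omega, twiceOddGF_succ]
        cases j with
        | zero =>
          rw [specialTopGF_odd_zero]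
          simp only [oddSetGF_zero_right, Nat.sub_zero]
          split_ifs <;> first | omega | ring
        | succ i =>
          rw [hL, show m + 1 - (i + 1) = m - i by omega]
          by_cases h : (m - i) % 2 = 1
          · rw [if_pos h, if_pos h, if_pos (by omega)]
            have h1 := oddSetGF_succ' m i
            have h2 := oddSetGF_succ m i
            obtain ⟨d, rfl⟩ : ∃ d, m = i + d := ⟨m - i, by omega⟩
            rw [show i + d - i = d by omega] at *
            -- One copy of the doubled term completes `oddSetGF_succ`; the other, with the even-top
            -- term, completes `oddSetGF_succ'` after extracting `X ^ (2d)`.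
            calc _ = (oddSetGF (i + d) (i + 1) + X ^ (2 * (i + d) + 1) * oddSetGF (i + d) i) *
                    twiceOddGF d + X ^ (2 * d) * (X ^ (2 * i + 2) * oddSetGF (i + d) (i + 1) +
                      X ^ (2 * i + 1) * oddSetGF (i + d) i) * twiceOddGF d := by ring
              _ = _ := by rw [← h1, ← h2]; ring
          · rw [if_neg h, if_neg h, if_neg (by omega), oddSetGF_succ]
            ring
    · intro j
      rw [show 2 * (m + 1) + 1 = 2 * m + 3 by ring, specialTopGF_odd, hF]
      cases j with
      | zero =>
        rw [specialTopGF_odd_zero]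
        simp only [oddSetGF_zero_right, Nat.sub_zero]
        split_ifs <;> first | omega | ring
      | succ i =>
        rw [hL, show m + 1 - (i + 1) = m - i by omega, oddSetGF_succ]
        rcases lt_or_ge m i with hi | hi
        · rw [oddSetGF_eq_zero hi, oddSetGF_eq_zero (show m < i + 1 by omega)]
          simp
        · by_cases h : (m - i) % 2 = 1
          · rw [if_pos h, if_pos (by omega)]
            ring
          · rw [if_neg h, if_neg (by omega)]
            ring

/-! ### Chains and their least parts -/

lemma twoString_leastPart (a k : ℕ) (hk : 0 < k) :
    leastPart ((range k).image (fun i => a + 2 * i)) = a := by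
  refine IsLeast.csInf_eq ⟨?_, ?_⟩
  · exact mem_coe.2 (mem_image.2 ⟨0, mem_range.2 hk, by simp⟩)
  · intro x hx
    obtain ⟨i, -, rfl⟩ := mem_image.1 (mem_coe.1 hx)
    exact Nat.le_add_right _ _

lemma mem_chains {n : ℕ} {π : n.Partition} {χ : Finset ℕ} :
    χ ∈ chains π ↔ Maximal (fun ψ => IsTwoString ψ ∧ ψ ⊆ π.parts.toFinset) χ := by
  classical
  unfold chains
  rw [mem_filter, mem_powerset]
  exact ⟨fun h => h.2, fun h => ⟨h.1.2, h⟩⟩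

lemma leastPart_mem_of_isTwoString {χ : Finset ℕ} (h : IsTwoString χ) : leastPart χ ∈ χ := by
  obtain ⟨a, k, hk, rfl⟩ := h
  rw [twoString_leastPart a k hk]
  exact mem_image.2 ⟨0, mem_range.2 hk, by simp⟩

lemma forall_odd_iff_of_isTwoString {χ : Finset ℕ} (h : IsTwoString χ) :
    (∀ b ∈ χ, Odd b) ↔ Odd (leastPart χ) := by
  refine ⟨fun H => H _ (leastPart_mem_of_isTwoString h), ?_⟩
  obtain ⟨a, k, hk, rfl⟩ := h
  rw [twoString_leastPart a k hk]
  intro ho b hb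
  obtain ⟨i, -, rfl⟩ := mem_image.1 hb
  exact ho.add_even (even_two_mul i)

lemma add_two_ne_leastPart {n : ℕ} {π : n.Partition} {χ : Finset ℕ} (h : χ ∈ chains π) :
    ∀ a ∈ π.parts.toFinset, a + 2 ≠ leastPart χ := by
  intro c hc he
  have hm := mem_chains.1 h
  obtain ⟨a, k, hk, rfl⟩ := hm.1.1
  rw [twoString_leastPart a k hk] at he
  subst he
  -- If `c` were a part, prepending it would give a longer string, against maximality.
  have hle := hm.2 (y := (range (k + 1)).image (fun i => c + 2 * i)) ⟨⟨c, k + 1, by omega, rfl⟩, ?_⟩ ?_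
  · have hmem : c ∈ (range k).image (fun i => c + 2 + 2 * i) :=
      hle (mem_image.2 ⟨0, by simp, by simp⟩)
    obtain ⟨i, -, hi⟩ := mem_image.1 hmem
    omega
  · intro x hx
    obtain ⟨i, hi, rfl⟩ := mem_image.1 hx
    cases i with
    | zero => exact hc
    | succ i =>
      exact hm.1.2 (mem_image.2 ⟨i, by simpa using hi, by ring⟩)
  · intro x hx
    obtain ⟨i, hi, rfl⟩ := mem_image.1 hx
    exact mem_image.2 ⟨i + 1, by simpa using hi, by ring⟩

lemma leastPart_injOn_chains {n : ℕ} {π : n.Partition} {χ ψ : Finset ℕ} (hχ : χ ∈ chains π)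
    (hψ : ψ ∈ chains π) (h : leastPart χ = leastPart ψ) : χ = ψ := by
  have h1 := mem_chains.1 hχ
  have h2 := mem_chains.1 hψ
  obtain ⟨a, k, hk, rfl⟩ := h1.1.1
  obtain ⟨b, l, hl, rfl⟩ := h2.1.1
  rw [twoString_leastPart a k hk, twoString_leastPart b l hl] at h
  subst h
  rcases le_total k l with hkl | hkl
  · have : (range k).image (fun i => a + 2 * i) ≤ (range l).image (fun i => a + 2 * i) :=
      image_subset_image (range_mono hkl)
    exact le_antisymm this (h1.2 h2.1 this)
  · have : (range l).image (fun i => a + 2 * i) ≤ (range k).image (fun i => a + 2 * i) :=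
      image_subset_image (range_mono hkl)
    exact le_antisymm (h2.2 h1.1 this) this

/-- The chain runs from `b` up to the first missing `b + 2i`. -/
lemma exists_chain_leastPart_eq {n : ℕ} {π : n.Partition} {b : ℕ} (hb : b ∈ π.parts.toFinset)
    (hs : ∀ a ∈ π.parts.toFinset, a + 2 ≠ b) : ∃ χ ∈ chains π, leastPart χ = b := by
  have hex : ∃ i, b + 2 * i ∉ π.parts.toFinset := by
    by_contra! H
    have := H (π.parts.toFinset.sup id + 1)
    have := le_sup (f := id) this
    simp only [id] at this
    omega
  classical
  have hk : 0 < Nat.find hex := by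
    rw [Nat.find_pos]
    simpa using hb
  refine ⟨(range (Nat.find hex)).image (fun i => b + 2 * i), mem_chains.2 ⟨⟨⟨b, _, hk, rfl⟩, ?_⟩, ?_⟩,
    twoString_leastPart _ _ hk⟩
  · intro x hx
    obtain ⟨i, hi, rfl⟩ := mem_image.1 hx
    exact not_not.1 (Nat.find_min hex (mem_range.1 hi))
  · rintro ψ ⟨⟨a, k, -, rfl⟩, hsub⟩ hle
    have hbm : b ∈ (range k).image (fun i => a + 2 * i) :=
      hle (mem_image.2 ⟨0, mem_range.2 hk, by simp⟩)
    obtain ⟨i, hi, hib⟩ := mem_image.1 hbm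
    cases i with
    | succ i =>
      refine absurd ?_ (hs (a + 2 * i) (hsub (mem_image.2 ⟨i, ?_, rfl⟩)))
      · rw [← hib]; ring
      · simp only [mem_range] at hi ⊢; omega
    | zero =>
      obtain rfl : a = b := by simpa using hib
      refine image_subset_image (range_mono ?_)
      by_contra! hlt
      exact Nat.find_spec hex (hsub (mem_image.2 ⟨_, mem_range.2 hlt, rfl⟩))

lemma oddBelow_eq {n : ℕ} {π : n.Partition} (h : π.parts.Nodup) (b : ℕ) :
    oddBelow π b = oddCountBelow π.parts.toFinset b := by
  unfold oddBelow oddCountBelow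
  rw [card_def, filter_val, Multiset.toFinset_val, h.dedup]

lemma isSpecial_iff {n : ℕ} (π : n.Partition) :
    IsSpecial π ↔ π.parts.Nodup ∧ IsSpecialSet π.parts.toFinset := by
  have h0 : 0 ∉ π.parts.toFinset := fun h => lt_irrefl _ (π.parts_pos (Multiset.mem_toFinset.1 h))
  unfold IsSpecial IsGollnitzGordon IsSpecialSet
  rw [and_assoc]
  refine and_congr_right fun hn => ?_
  simp only [h0, not_false_eq_true, true_and, Multiset.mem_toFinset]
  refine and_congr_right fun _ => forall₃_congr fun b _ _ => ?_
  rw [oddBelow_eq hn, Int.ModEq]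
  omega

lemma weight_eq {n : ℕ} {π : n.Partition} (hn : π.parts.Nodup) :
    weight π = setWeight π.parts.toFinset := by
  classical
  have hR : setWeight π.parts.toFinset =
      ∏ b ∈ π.parts.toFinset.filter (fun b => ∀ a ∈ π.parts.toFinset, a + 2 ≠ b),
        if Odd b ∧ b % 4 = (2 * oddCountBelow π.parts.toFinset b + 3) % 4 then 2 else 1 := by
    rw [setWeight, prod_filter]
    refine prod_congr rfl fun b _ => ?_
    by_cases h : ∀ a ∈ π.parts.toFinset, a + 2 ≠ b
    · simp only [if_pos h]
      exact if_congr ⟨fun H => ⟨H.1, H.2.2⟩, fun H => ⟨H.1, h, H.2⟩⟩ rfl rfl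
    · rw [if_neg h, if_neg (fun H => h H.2.1)]
  rw [hR, weight]
  refine prod_bij (fun χ _ => leastPart χ) ?_ ?_ ?_ ?_
  · intro χ hχ
    have hm := (mem_chains.1 hχ).1
    exact mem_filter.2 ⟨hm.2 (leastPart_mem_of_isTwoString hm.1), add_two_ne_leastPart hχ⟩
  · exact fun χ hχ ψ hψ h => leastPart_injOn_chains hχ hψ h
  · intro b hb
    obtain ⟨hb, hs⟩ := mem_filter.1 hb
    obtain ⟨χ, hχ, h⟩ := exists_chain_leastPart_eq hb hs
    exact ⟨χ, hχ, h⟩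
  · intro χ hχ
    unfold chainWeight
    refine if_congr ?_ rfl rfl
    rw [forall_odd_iff_of_isTwoString (mem_chains.1 hχ).1.1, oddBelow_eq hn, Int.ModEq]
    refine and_congr_right fun ho => ?_
    -- The condition `3 ≤ leastPart χ` is automatic: for least part 1 the count is 0, and `1 ≢ -1
    -- (mod 4)`.
    have h1 : leastPart χ = 1 → oddCountBelow π.parts.toFinset (leastPart χ) = 0 := by
      intro e
      rw [e, oddCountBelow, card_eq_zero, filter_eq_empty_iff]
      rintro a - ⟨ha, hlt⟩
      obtain rfl : a = 0 := by omega
      simp at ha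
    obtain ⟨i, hi⟩ := ho
    omega

/-! ### Comparison of coefficients -/

/-- A sum over partitions of `n` into distinct parts, as a sum over sets of positive numbers. -/
lemma sum_partition_nodup {n N : ℕ} (hN : n < N) (p : Finset ℕ → Prop) [DecidablePred p]
    (f : Finset ℕ → ℕ) :
    ∑ π ∈ (univ : Finset n.Partition).filter (fun π => π.parts.Nodup ∧ p π.parts.toFinset),
        f π.parts.toFinset =
      ∑ S ∈ (range N).powerset.filter (fun S => (0 ∉ S ∧ p S) ∧ ∑ i ∈ S, i = n), f S := by
  refine sum_bij (fun π _ => π.parts.toFinset) ?_ ?_ ?_ (fun _ _ => rfl)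
  · intro π hπ
    obtain ⟨-, hn, hp⟩ := mem_filter.1 hπ
    have hsum : ∑ i ∈ π.parts.toFinset, i = n := by
      rw [Finset.sum, Multiset.toFinset_val, hn.dedup, Multiset.map_id', π.parts_sum]
    refine mem_filter.2 ⟨mem_powerset.2 fun a ha => mem_range.2 ?_, ⟨fun h => ?_, hp⟩, hsum⟩
    · have := single_le_sum (f := fun i : ℕ => i) (fun _ _ => Nat.zero_le _) ha
      simp only [hsum] at this
      omega
    · exact lt_irrefl _ (π.parts_pos (Multiset.mem_toFinset.1 h))
  · intro π hπ ρ hρ h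
    have h1 := (mem_filter.1 hπ).2.1
    have h2 := (mem_filter.1 hρ).2.1
    apply Nat.Partition.ext
    rw [← h1.dedup, ← h2.dedup, ← Multiset.toFinset_val, ← Multiset.toFinset_val, h]
  · intro S hS
    obtain ⟨-, ⟨h0, hp⟩, hs⟩ := mem_filter.1 hS
    refine ⟨⟨S.val, fun {i} hi => Nat.pos_of_ne_zero ?_, ?_⟩, ?_, ?_⟩
    · rintro rfl; exact h0 hi
    · rw [← hs, Finset.sum, Multiset.map_id']
    · refine mem_filter.2 ⟨mem_univ _, S.nodup, ?_⟩
      simpa using hp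
    · simp

open Classical in
lemma sum_weight_eq_coeff (n m : ℕ) (h : n < 2 * m + 1) :
    ∑ π ∈ (univ : Finset n.Partition).filter (fun π => IsSpecial π), weight π =
      (∑ j ∈ range (m + 1), specialGF (2 * m + 1) j).coeff n := by
  have e1 : ∑ π ∈ (univ : Finset n.Partition).filter (fun π => IsSpecial π), weight π =
      ∑ π ∈ (univ : Finset n.Partition).filter
        (fun π => π.parts.Nodup ∧ IsSpecialSet π.parts.toFinset), setWeight π.parts.toFinset := by
    rw [filter_congr fun π _ => isSpecial_iff π]
    exact sum_congr rfl fun π hπ => weight_eq (mem_filter.1 hπ).2.1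
  rw [e1, sum_partition_nodup h]
  unfold specialGF
  rw [sum_comm, finsetSum_coeff, sum_filter]
  refine sum_congr rfl fun S hS => ?_
  have hodd : oddCount S ∈ range (m + 1) := by
    rw [mem_range, Nat.lt_succ_iff]
    have hsub : S.filter (fun a => Odd a) ⊆ (range m).image (fun i => 2 * i + 1) := by
      intro a ha
      obtain ⟨ha, i, rfl⟩ := mem_filter.1 ha
      have := lt_of_mem_powerset_range hS _ ha
      exact mem_image.2 ⟨i, mem_range.2 (by omega), rfl⟩
    exact (card_le_card hsub).trans (card_image_le.trans (card_range m).le)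
  rw [sum_eq_single_of_mem _ hodd]
  · by_cases hs : IsSpecialSet S
    · have ht : specialTerm (oddCount S) S = (setWeight S : ℕ[X]) * X ^ (∑ i ∈ S, i) :=
        if_pos ⟨hs, rfl⟩
      rw [ht, ← C_eq_natCast, coeff_C_mul_X_pow]
      exact if_congr ⟨fun H => H.2.symm, fun H => ⟨⟨hs.1, hs⟩, H.symm⟩⟩ rfl rfl
    · have ht : specialTerm (oddCount S) S = 0 := if_neg fun H => hs H.1
      rw [ht, if_neg (fun H => hs H.1.2), coeff_zero]
  · exact fun j _ hj => if_neg fun H => hj H.2.symm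

lemma coeff_mul_twiceOddGF (A : ℕ[X]) {n v w : ℕ} (hv : n < v) (hw : v ≤ w) :
    (A * twiceOddGF w).coeff n = (A * twiceOddGF v).coeff n := by
  induction w, hw using Nat.le_induction with
  | base => rfl
  | succ w hw ih =>
    rw [twiceOddGF_succ, ← ih]
    split_ifs
    · rw [mul_add, mul_one, mul_add, coeff_add, ← mul_assoc, coeff_mul_X_pow', if_neg (by omega),
        add_zero]
    · rw [mul_one]

lemma coeff_oddSetGF_mul (B : ℕ[X]) {m j n : ℕ} (h : n < j) : (oddSetGF m j * B).coeff n = 0 :=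
  X_pow_dvd_iff.1 ((X_pow_dvd_oddSetGF m j).mul_right B) n h

/-- With `m = 2n`, terms with `j > n` are divisible by `X ^ j`. For `j ≤ n` the cutoff `2n + 1 - j`
exceeds `n`, so the missing factors do not affect degree `n`. -/
lemma coeff_sum_specialGF (n : ℕ) :
    (∑ j ∈ range (2 * n + 1), specialGF (2 * (2 * n) + 1) j).coeff n =
      ((∏ i ∈ range (2 * n), (1 + X ^ (2 * i + 1))) * twiceOddGF (2 * n + 1)).coeff n := by
  rw [← sum_oddSetGF, sum_mul, finsetSum_coeff, finsetSum_coeff]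
  refine sum_congr rfl fun j _ => ?_
  rw [(special_gf (2 * n)).1 j]
  rcases lt_or_ge n j with hj | hj
  · rw [coeff_oddSetGF_mul _ hj, coeff_oddSetGF_mul _ hj]
  · exact (coeff_mul_twiceOddGF _ (by omega) (by omega)).symm

lemma Q₀_eq_coeff (n : ℕ) : Q₀ n =
    ((∏ i ∈ range (2 * n), (1 + X ^ (2 * i + 1))) * twiceOddGF (2 * n + 1) : ℕ[X]).coeff n := by
  -- `A` agrees with the set of admissible parts up to `n`, which is all that degree `n` sees.
  set A := (range (2 * n)).image (fun i => 2 * i + 1) ∪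
    ((range (2 * n + 1)).filter (fun e => e % 2 = 1)).image (fun e => 2 * e) with hA
  have hmem : ∀ a, a ≤ n → (a ∈ A ↔ a ≠ 0 ∧ ¬ a ≡ 0 [MOD 4]) := by
    intro a ha
    simp only [hA, mem_union, mem_image, mem_filter, mem_range, Nat.ModEq]
    constructor
    · rintro (⟨i, -, rfl⟩ | ⟨e, ⟨-, he⟩, rfl⟩) <;> omega
    · rintro ⟨h0, h4⟩
      rcases Nat.mod_two_eq_zero_or_one a with h | h
      · exact Or.inr ⟨a / 2, by omega, by omega⟩
      · exact Or.inl ⟨a / 2, by omega, by omega⟩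
  have hprod : (∏ i ∈ range (2 * n), (1 + X ^ (2 * i + 1))) * twiceOddGF (2 * n + 1) =
      ∏ a ∈ A, (1 + X ^ a : ℕ[X]) := by
    rw [hA, prod_union, prod_image, prod_image, twiceOddGF]
    · intro a _ b _ h; simpa using h
    · intro a _ b _ h; simpa using h
    · rw [disjoint_left]
      intro a h1 h2
      obtain ⟨i, -, rfl⟩ := mem_image.1 h1
      obtain ⟨e, -, he⟩ := mem_image.1 h2
      omega
  have hQ : Q₀ n = ∑ π ∈ (univ : Finset n.Partition).filter
      (fun π => π.parts.Nodup ∧ ∀ b ∈ π.parts.toFinset, ¬ b ≡ 0 [MOD 4]), 1 := by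
    rw [Q₀, card_eq_sum_ones]
    refine sum_congr (filter_congr fun π _ => ?_) fun _ _ => rfl
    simp only [Multiset.mem_toFinset]
  rw [hQ, sum_partition_nodup (Nat.lt_succ_self n) (fun S => ∀ b ∈ S, ¬ b ≡ 0 [MOD 4]) (fun _ => 1),
    hprod, prod_one_add, finsetSum_coeff]
  have hX : ∀ S : Finset ℕ, ∏ i ∈ S, (X : ℕ[X]) ^ i = X ^ (∑ i ∈ S, i) := fun S =>
    prod_pow_eq_pow_sum S (fun i => i) X
  simp only [hX, coeff_X_pow]
  rw [← sum_filter]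
  refine sum_congr ?_ fun _ _ => rfl
  ext S
  simp only [mem_filter, mem_powerset]
  constructor
  · rintro ⟨hS, ⟨h0, h4⟩, hs⟩
    refine ⟨fun a ha => (hmem a ?_).2 ⟨fun e => h0 (e ▸ ha), h4 a ha⟩, hs.symm⟩
    have := mem_range.1 (hS ha)
    omega
  · rintro ⟨hS, hs⟩
    have hle : ∀ a ∈ S, a ≤ n := by
      intro a ha
      rw [hs]
      exact single_le_sum (f := fun i : ℕ => i) (fun _ _ => Nat.zero_le _) ha
    refine ⟨fun a ha => mem_range.2 (Nat.lt_succ_of_le (hle a ha)), ⟨fun h => ?_, fun a ha => ?_⟩, hs.symm⟩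
    · exact ((hmem 0 (Nat.zero_le _)).1 (hS h)).1 rfl
    · exact ((hmem a (hle a ha)).1 (hS ha)).2

open Classical in
theorem theorem4 (n : ℕ) :
    Q₀ n = ∑ π ∈ (Finset.univ : Finset n.Partition).filter (fun π => IsSpecial π), weight π := by
  rw [Q₀_eq_coeff, sum_weight_eq_coeff n (2 * n) (by omega), coeff_sum_specialGF]
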